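/- Let $D=\,]0,\infty[\,\times\mathbb R$. For $x,y\in D$ write $x\prec y$ if $x_2<y_2$; for $z=(t,x)$, $w=(T,y)$ in $\mathbb R\times D$ write $z\prec w$ if $x\prec y$ and $t<T$. Put $\mathbf 1=(0,1,0)$ and $$\mathbf h(z;w)=\frac{(T-t)\sqrt{x_1y_1}}{y_2-x_2},\qquad H_1(z;w)=\frac{\sqrt{12}}{2\pi (T-t)^2y_1^2}\,e^{-\frac12\Psi(z;w)},\qquad \widetilde g(r)=\sqrt r+r,$$ where $\Psi(z;w)$ is the optimal cost: the infimum of $\int_t^T|\omega(s)|^2\,ds$ over all $\omega\in L^2([t,T])$ for which there is an absolutely continuous curve $\gamma=(\gamma_1,\gamma_2):[t,T]\to D$ with $\dot\gamma_1=\omega\gamma_1$, $\dot\gamma_2=\gamma_1$ a.e., $\gamma(t)=x$, $\gamma(T)=y$. It is $+\infty$ (so that $H_1(z;w)=0$) if no such control exists, in particular if $t<T$ and $x_2\ge y_2$; then products with the factor $H_1(z;w)$ are also read as $0$. For $\varphi\in\{\sqrt{\cdot},\widetilde g\}$ put $K_\varphi(z;w)=\varphi(\mathbf h(z;w))\,H_1(z;w)$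 and, for $t<s<0$ and $x\in D$ with $x_2<0$, $$D_\varphi(t,s,x)=\big\{\xi\in D:\ \min\big(K_\varphi(t,x;s,\xi),\,K_\varphi(s,\xi;\mathbf 1)\big)>K_\varphi(t,x;\mathbf 1)\big\},$$ and write $D(t,s,x)=D_{\sqrt{\cdot}}(t,s,x)$, $D'(t,s,x)=D_{\widetilde g}(t,s,x)$. For $\tau>0$, say that the Key Inequalities hold for $\tau$ if there is a constant $C_\tau>0$ such that for both $\varphi=\sqrt{\cdot}$ and $\varphi=\widetilde g$ $$\int_{\{\xi\in D:\ x\prec\xi\prec(1,0)\}}K_\varphi(t,x;s,\xi)\,K_\varphi(s,\xi;\mathbf 1)\,d\xi\ \le\ C_\tau\,K_\varphi(t,x;\mathbf 1)\qquad(1)$$ for all $z=(t,x)\in\mathbb R\times D$ with $z\prec\mathbf 1$, $t>-\tau$, and all $s\in\,]t,0[$. The Key Inequalities are said to hold if they hold for every $\tau>0$. **Proposition.** The sets $D(t,s,x)$ and $D'(t,s,x)$ are bounded for all $t<s<0$ and $x\in D$ with $x_2<0$. The Key Inequalities hold if and only if for every $\tau>0$ there is a constant $\kappa_\tau>0$ such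 that for both $\varphi=\sqrt{\cdot}$ and $\varphi=\widetilde g$ $$\int_{\{\xi\in D:\ x\prec\xi\prec(1,0)\}}\mathbf 1_{D_\varphi(t,s,x)}(\xi)\,K_\varphi(t,x;s,\xi)\,K_\varphi(s,\xi;\mathbf 1)\,d\xi\ \le\ \kappa_\tau\,K_\varphi(t,x;\mathbf 1)\qquad(2)$$ for all $z=(t,x)\in\mathbb R\times D$ with $z\prec\mathbf 1$, $t>-\tau$, and all $s\in\,]t,0[$. Moreover, this equivalence holds for each single $\tau>0$: the Key Inequalities hold for $\tau$ if and only if there is a $\kappa_\tau>0$ as in (2). -/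

import Mathlib

open MeasureTheory Set

noncomputable section

namespace Asian

/-- The state space `D = ]0, ∞[ × ℝ`. -/
def stateSpace : Set (ℝ × ℝ) := {x | 0 < x.1}

/-- The relation `x ≺ y` on `D`. -/
def Prec (x y : ℝ × ℝ) : Prop := x.2 < y.2

/-- The relation `z ≺ w` on `ℝ × D`, where `z = (t, x)` and `w = (T, y)`. -/
def PrecST (z w : ℝ × ℝ × ℝ) : Prop := Prec z.2 w.2 ∧ z.1 < w.1

/-- The unit `(0, 1, 0)` of the group structure on `ℝ × D`. -/
def unitG : ℝ × ℝ × ℝ := (0, 1, 0)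

/-- `𝐡(z; w) = (T - t) √(x₁ y₁) / (y₂ - x₂)` for `z = (t, x)`, `w = (T, y)`. -/
def h (z w : ℝ × ℝ × ℝ) : ℝ :=
  (w.1 - z.1) * Real.sqrt (z.2.1 * w.2.1) / (w.2.2 - z.2.2)

/-- The control `ω ∈ L²([t, T])` steers `x` at time `t` to `y` at time `T` along the curve
`γ = (γ₁, γ₂)` in `D`: the curve is absolutely continuous on `[t, T]`, solves
`γ₁' = ω γ₁`, `γ₂' = γ₁` almost everywhere, and has the prescribed end points. -/
structure Steers (z w : ℝ × ℝ × ℝ) (ω γ₁ γ₂ : ℝ → ℝ) : Prop where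
  memLp : MemLp ω 2 (volume.restrict (Icc z.1 w.1))
  ac₁ : AbsolutelyContinuousOnInterval γ₁ z.1 w.1
  ac₂ : AbsolutelyContinuousOnInterval γ₂ z.1 w.1
  mem : ∀ s ∈ Icc z.1 w.1, (γ₁ s, γ₂ s) ∈ stateSpace
  ode₁ : ∀ᵐ s ∂volume, s ∈ Ioo z.1 w.1 → HasDerivAt γ₁ (ω s * γ₁ s) s
  ode₂ : ∀ᵐ s ∂volume, s ∈ Ioo z.1 w.1 → HasDerivAt γ₂ (γ₁ s) s
  start : (γ₁ z.1, γ₂ z.1) = z.2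
  finish : (γ₁ w.1, γ₂ w.1) = w.2

/-- The optimal cost `Ψ(z; w)`: the least value of `∫ |ω|²` over the controls that steer `z` to
`w`; it is `+∞` if there is no such control (an infimum over the empty set). -/
def Psi (z w : ℝ × ℝ × ℝ) : ENNReal :=
  ⨅ (ω : ℝ → ℝ) (γ₁ : ℝ → ℝ) (γ₂ : ℝ → ℝ) (_ : Steers z w ω γ₁ γ₂),
    ENNReal.ofReal (∫ s in z.1..w.1, |ω s| ^ 2)

/-- `exp (-c / 2)`, with the value `0` at `c = +∞`. -/
def expNegHalf (c : ENNReal) : ℝ :=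
  if c = ⊤ then 0 else Real.exp (-(1 / 2) * c.toReal)

/-- The pre-parametrix `H₁(z; w) = √12 / (2 π (T - t)² y₁²) · exp (-Ψ(z; w) / 2)`. -/
def H1 (z w : ℝ × ℝ × ℝ) : ℝ :=
  Real.sqrt 12 / (2 * Real.pi * (w.1 - z.1) ^ 2 * w.2.1 ^ 2) * expNegHalf (Psi z w)

/-- The function `g̃(h) = √h + h`. -/
def gTilde (r : ℝ) : ℝ := Real.sqrt r + r

/-- The kernel `φ(𝐡(z; w)) H₁(z; w)`; it is used with `φ = √` and with `φ = g̃`. -/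
def kernel (φ : ℝ → ℝ) (z w : ℝ × ℝ × ℝ) : ℝ := φ (h z w) * H1 z w

/-- The domain of integration `x ≺ ξ ≺ (1, 0)`, `ξ ∈ D`. -/
def strip (x : ℝ × ℝ) : Set (ℝ × ℝ) := {ξ ∈ stateSpace | Prec x ξ ∧ Prec ξ (1, 0)}

/-- The set of `ξ ∈ D` at which both kernels exceed the kernel from `(t, x)` to the unit:
this is `D(t, s, x)` for `φ = √` and `D'(t, s, x)` for `φ = g̃`. -/
def region (φ : ℝ → ℝ) (t s : ℝ) (x : ℝ × ℝ) : Set (ℝ × ℝ) :=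
  {ξ ∈ stateSpace |
    kernel φ (t, x) unitG < min (kernel φ (t, x) (s, ξ)) (kernel φ (s, ξ) unitG)}

/-- The convolution bound with constant `C` for all `z = (t, x) ≺ 1` with `t > -τ` and all
`s ∈ ]t, 0[`. The integrand is nonnegative, so the integral is taken in `[0, ∞]`. -/
def ConvBound (φ : ℝ → ℝ) (τ C : ℝ) : Prop :=
  ∀ (t : ℝ) (x : ℝ × ℝ), x ∈ stateSpace → PrecST (t, x) unitG → -τ < t → ∀ s ∈ Ioo t 0,
    ∫⁻ ξ in strip x, ENNReal.ofReal (kernel φ (t, x) (s, ξ) * kernel φ (s, ξ) unitG)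
      ≤ ENNReal.ofReal (C * kernel φ (t, x) unitG)

/-- The same bound with the integrand multiplied by the indicator function of the region. -/
def ConvBoundOnRegion (φ : ℝ → ℝ) (τ C : ℝ) : Prop :=
  ∀ (t : ℝ) (x : ℝ × ℝ), x ∈ stateSpace → PrecST (t, x) unitG → -τ < t → ∀ s ∈ Ioo t 0,
    ∫⁻ ξ in strip x, ENNReal.ofReal
        ((region φ t s x).indicator (fun _ => (1 : ℝ)) ξ
          * kernel φ (t, x) (s, ξ) * kernel φ (s, ξ) unitG)
      ≤ ENNReal.ofReal (C * kernel φ (t, x) unitG)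

/-- The Key Inequalities for one `τ`. -/
def KeyInequalitiesAt (τ : ℝ) : Prop :=
  ∃ C > 0, ConvBound Real.sqrt τ C ∧ ConvBound gTilde τ C

/-- The Key Inequalities for one `τ`, with the integrals restricted to the regions. -/
def ReducedInequalitiesAt (τ : ℝ) : Prop :=
  ∃ κ > 0, ConvBoundOnRegion Real.sqrt τ κ ∧ ConvBoundOnRegion gTilde τ κ

/-- The Key Inequalities. -/
def KeyInequalities : Prop := ∀ τ > 0, KeyInequalitiesAt τ

end Asian

end

/-! Write K₁, K₂ for the two factors under the integral and K for the kernel from (t, x) to the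
unit. Off the region one factor is at most K, so K₁K₂ ≤ K(K₁ + K₂). The full and restricted
integrals thus differ by at most K times ∫K₁ + ∫K₂, and it suffices to bound these two integrals in
terms of τ alone (`lintegral_majorant_le`).

This rests on `le_Psi`: the kernel is at most a Gaussian in log(y₁/x₁) and log 𝐡. In these
logarithmic coordinates all powers of the time step and of the fixed point cancel, so nothing blows
up as s tends to t or to 0.

The same Gaussian gives K₁ ≤ C/ξ₁² (`kernel_le_const`), which bounds ξ₁ on the region because K > 0;
that positivity is finiteness of the cost (`exists_steers`). The coordinate ξ₂ lies in ]x₂, 0[,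
since elsewhere a factor vanishes. Of φ only 0 < φ ≤ g̃ on ]0, ∞[ is used. -/

/-! ### Absolutely continuous functions and Cauchy–Schwarz -/

theorem AbsolutelyContinuousOnInterval.lipschitzOnWith_comp {f g : ℝ → ℝ} {a b : ℝ} {K : NNReal}
    {S : Set ℝ} (hf : AbsolutelyContinuousOnInterval f a b) (hg : LipschitzOnWith K g S)
    (hS : MapsTo f (uIcc a b) S) : AbsolutelyContinuousOnInterval (fun s => g (f s)) a b := by
  rw [absolutelyContinuousOnInterval_iff] at hf ⊢
  intro ε hε
  -- `K + 1` instead of `K`, which may be zero.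
  obtain ⟨δ, hδ, H⟩ := hf (ε / (K + 1)) (by positivity)
  refine ⟨δ, hδ, fun E hE hlt => ?_⟩
  have h1 := H E hE hlt
  have hmem : ∀ i ∈ Finset.range E.1, (E.2 i).1 ∈ uIcc a b ∧ (E.2 i).2 ∈ uIcc a b := hE.1
  calc ∑ i ∈ Finset.range E.1, dist (g (f (E.2 i).1)) (g (f (E.2 i).2))
      ≤ ∑ i ∈ Finset.range E.1, K * dist (f (E.2 i).1) (f (E.2 i).2) :=
        Finset.sum_le_sum fun i hi =>
          hg.dist_le_mul _ (hS (hmem i hi).1) _ (hS (hmem i hi).2)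
    _ = K * ∑ i ∈ Finset.range E.1, dist (f (E.2 i).1) (f (E.2 i).2) := by
        rw [Finset.mul_sum]
    _ ≤ K * (ε / (K + 1)) := by gcongr
    _ < ε := by
        rw [mul_div_assoc', div_lt_iff₀ (by positivity)]
        nlinarith [K.2]

/-- By compactness the function stays above a positive minimum, and the logarithm is Lipschitz
there. -/
theorem AbsolutelyContinuousOnInterval.log {f : ℝ → ℝ} {a b : ℝ}
    (hf : AbsolutelyContinuousOnInterval f a b) (hpos : ∀ s ∈ uIcc a b, 0 < f s) :
    AbsolutelyContinuousOnInterval (fun s => Real.log (f s)) a b := by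
  obtain ⟨m, hm, hmin⟩ := isCompact_uIcc.exists_isMinOn nonempty_uIcc hf.continuousOn
  have hm0 := hpos m hm
  have hlip : LipschitzOnWith (Real.toNNReal (1 / f m)) Real.log (Ici (f m)) := by
    refine (convex_Ici _).lipschitzOnWith_of_nnnorm_hasDerivWithin_le (f' := fun y => y⁻¹)
      (fun y hy => (Real.hasDerivAt_log (hm0.trans_le hy).ne').hasDerivWithinAt) fun y hy => ?_
    rw [← NNReal.coe_le_coe, coe_nnnorm, Real.coe_toNNReal _ (by positivity), Real.norm_eq_abs,
      abs_of_pos (inv_pos.2 (hm0.trans_le hy)), one_div]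
    exact inv_anti₀ hm0 hy
  exact hf.lipschitzOnWith_comp hlip fun s hs => hmin hs

theorem AbsolutelyContinuousOnInterval.integral_eq_sub_of_hasDerivAt {f f' : ℝ → ℝ} {a b : ℝ}
    (hab : a ≤ b) (hf : AbsolutelyContinuousOnInterval f a b)
    (hd : ∀ᵐ s ∂volume, s ∈ Ioo a b → HasDerivAt f (f' s) s) :
    ∫ s in a..b, f' s = f b - f a := by
  rw [← hf.integral_deriv_eq_sub]
  apply intervalIntegral.integral_congr_ae
  have hb : ∀ᵐ s ∂(volume : Measure ℝ), s ≠ b := by simp [ae_iff]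
  filter_upwards [hd, hb] with s hs hsb hmem
  rw [uIoc_of_le hab] at hmem
  exact (hs ⟨hmem.1, lt_of_le_of_ne hmem.2 hsb⟩).deriv.symm

/-- Cauchy–Schwarz, read off from the nonnegative variance of |ω| about its mean. -/
theorem sq_intervalIntegral_abs_le {ω : ℝ → ℝ} {a b : ℝ} (hab : a < b)
    (hω : MemLp ω 2 (volume.restrict (Icc a b))) :
    (∫ s in a..b, |ω s|) ^ 2 / (b - a) ≤ ∫ s in a..b, |ω s| ^ 2 := by
  have hi1 : IntervalIntegrable (fun s => |ω s|) volume a b := by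
    rw [intervalIntegrable_iff_integrableOn_Icc_of_le hab.le]
    exact (hω.integrable (by norm_num)).abs
  have hi2 : IntervalIntegrable (fun s => |ω s| ^ 2) volume a b := by
    rw [intervalIntegrable_iff_integrableOn_Icc_of_le hab.le]
    simpa only [sq_abs] using! hω.integrable_sq
  set I := ∫ s in a..b, |ω s|
  have hT : 0 < b - a := sub_pos.2 hab
  set c := I / (b - a)
  have h0 : 0 ≤ ∫ s in a..b, (|ω s| - c) ^ 2 :=
    intervalIntegral.integral_nonneg hab.le fun s _ => sq_nonneg _
  have h1 : ∫ s in a..b, (|ω s| - c) ^ 2 =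
      (∫ s in a..b, |ω s| ^ 2) - 2 * c * I + (b - a) * c ^ 2 := by
    have : (fun s => (|ω s| - c) ^ 2) = fun s => |ω s| ^ 2 - 2 * c * |ω s| + c ^ 2 := by
      ext s; ring
    rw [this, intervalIntegral.integral_add (hi2.sub (hi1.const_mul _)) (by simp),
      intervalIntegral.integral_sub hi2 (hi1.const_mul _), intervalIntegral.integral_const_mul]
    simp [I]
  have h2 : 2 * c * I - (b - a) * c ^ 2 = I ^ 2 / (b - a) := by
    simp only [c]; field_simp; ring
  linarith

namespace Asian

/-! ### Lower bound for the optimal cost -/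

/-- The control is the logarithmic derivative of γ₁. -/
theorem Steers.abs_log_sub_log_le {z w : ℝ × ℝ × ℝ} {ω γ₁ γ₂ : ℝ → ℝ} (hS : Steers z w ω γ₁ γ₂)
    {a b : ℝ} (ha : z.1 ≤ a) (hab : a ≤ b) (hb : b ≤ w.1) :
    |Real.log (γ₁ b) - Real.log (γ₁ a)| ≤ ∫ s in a..b, |ω s| := by
  have hsub : Icc a b ⊆ Icc z.1 w.1 := Icc_subset_Icc ha hb
  have hpos : ∀ s ∈ Icc z.1 w.1, 0 < γ₁ s := hS.mem
  have hac : AbsolutelyContinuousOnInterval γ₁ a b :=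
    hS.ac₁.mono (by rwa [uIcc_of_le hab, uIcc_of_le (ha.trans (hab.trans hb))])
  have hlog := hac.log fun s hs => hpos s (hsub (by rwa [uIcc_of_le hab] at hs))
  have hint := hlog.integral_eq_sub_of_hasDerivAt (f' := ω) hab (by
    filter_upwards [hS.ode₁] with s hs hmem
    have hp := hpos s (hsub (Ioo_subset_Icc_self hmem))
    convert! (hs ⟨ha.trans_lt hmem.1, hmem.2.trans_le hb⟩).log hp.ne' using 1
    field_simp)
  rw [← hint]
  exact intervalIntegral.abs_integral_le_integral_abs hab

theorem Steers.integral_eq {z w : ℝ × ℝ × ℝ} {ω γ₁ γ₂ : ℝ → ℝ} (hS : Steers z w ω γ₁ γ₂)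
    (hT : z.1 ≤ w.1) : ∫ s in z.1..w.1, γ₁ s = w.2.2 - z.2.2 := by
  rw [hS.ac₂.integral_eq_sub_of_hasDerivAt hT hS.ode₂]
  rw [← congrArg Prod.snd hS.start, ← congrArg Prod.snd hS.finish]

/-- The mean of the first component of an admissible curve is attained. -/
theorem Steers.exists_eq_mean {z w : ℝ × ℝ × ℝ} {ω γ₁ γ₂ : ℝ → ℝ} (hS : Steers z w ω γ₁ γ₂)
    (hT : z.1 < w.1) : ∃ c ∈ Icc z.1 w.1, γ₁ c = (w.2.2 - z.2.2) / (w.1 - z.1) := by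
  obtain ⟨c, hc, h⟩ := exists_eq_interval_average hT.ne hS.ac₁.continuousOn
  rw [uIoo_of_lt hT] at hc
  refine ⟨c, Ioo_subset_Icc_self hc, ?_⟩
  rw [h, interval_average_eq_div, hS.integral_eq hT.le]

theorem Steers.snd_lt {z w : ℝ × ℝ × ℝ} {ω γ₁ γ₂ : ℝ → ℝ} (hS : Steers z w ω γ₁ γ₂)
    (hT : z.1 < w.1) : z.2.2 < w.2.2 := by
  obtain ⟨c, hc, h⟩ := hS.exists_eq_mean hT
  have h0 : 0 < γ₁ c := hS.mem c hc
  rw [h] at h0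
  have := (div_pos_iff_of_pos_right (sub_pos.2 hT)).1 h0
  linarith

theorem Psi_eq_top {z w : ℝ × ℝ × ℝ} (hT : z.1 < w.1) (h : w.2.2 ≤ z.2.2) : Psi z w = ⊤ := by
  simp only [Psi, iInf_eq_top]
  intro ω γ₁ γ₂ hS
  exact absurd (hS.snd_lt hT) h.not_gt

theorem log_h {z w : ℝ × ℝ × ℝ} (hT : z.1 < w.1) (hz : 0 < z.2.1) (hw : 0 < w.2.1)
    (h2 : z.2.2 < w.2.2) : 2 * Real.log (h z w) = Real.log z.2.1 + Real.log w.2.1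
      - 2 * Real.log ((w.2.2 - z.2.2) / (w.1 - z.1)) := by
  have hT' := sub_pos.2 hT
  have hA := sub_pos.2 h2
  rw [h, Real.log_div (by positivity) hA.ne', Real.log_mul hT'.ne' (by positivity),
    Real.log_sqrt (by positivity), Real.log_mul hz.ne' hw.ne', Real.log_div hA.ne' hT'.ne']
  ring

/-- The optimal cost controls the squared logarithms of `y₁ / x₁` and of `𝐡(z; w)`. -/
theorem le_Psi {z w : ℝ × ℝ × ℝ} (hT : z.1 < w.1) (h2 : z.2.2 < w.2.2) :
    ENNReal.ofReal ((Real.log w.2.1 - Real.log z.2.1) ^ 2 / (2 * (w.1 - z.1))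
      + 2 * Real.log (h z w) ^ 2 / (w.1 - z.1)) ≤ Psi z w := by
  simp only [Psi, le_iInf_iff]
  intro ω γ₁ γ₂ hS
  apply ENNReal.ofReal_le_ofReal
  have hT' := sub_pos.2 hT
  have hs : γ₁ z.1 = z.2.1 := congrArg Prod.fst hS.start
  have hf : γ₁ w.1 = w.2.1 := congrArg Prod.fst hS.finish
  have hz : 0 < z.2.1 := hs ▸ hS.mem z.1 ⟨le_rfl, hT.le⟩
  have hw : 0 < w.2.1 := hf ▸ hS.mem w.1 ⟨hT.le, le_rfl⟩
  obtain ⟨c, hc, hmean⟩ := hS.exists_eq_mean hT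
  have hle := sq_intervalIntegral_abs_le hT hS.memLp
  have hi : IntegrableOn (fun s => |ω s|) (Icc z.1 w.1) := (hS.memLp.integrable (by norm_num)).abs
  have hadd : (∫ s in z.1..c, |ω s|) + (∫ s in c..w.1, |ω s|) = ∫ s in z.1..w.1, |ω s| :=
    intervalIntegral.integral_add_adjacent_intervals
      ((intervalIntegrable_iff_integrableOn_Icc_of_le hc.1).2
        (hi.mono_set (Icc_subset_Icc_right hc.2)))
      ((intervalIntegrable_iff_integrableOn_Icc_of_le hc.2).2
        (hi.mono_set (Icc_subset_Icc_left hc.1)))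
  have e1 := hS.abs_log_sub_log_le le_rfl hT.le le_rfl
  have e2 := abs_le.1 (hS.abs_log_sub_log_le le_rfl hc.1 hc.2)
  have e3 := abs_le.1 (hS.abs_log_sub_log_le hc.1 hc.2 le_rfl)
  rw [hs, hf] at e1
  rw [hs] at e2
  rw [hf] at e3
  -- Since γ₁ equals its mean at c, 2 log 𝐡 is the sum of the differences of log γ₁ between each end
  -- point and c; each is controlled by ω on its own side of c.
  have e4 : |2 * Real.log (h z w)| ≤ ∫ s in z.1..w.1, |ω s| := by
    rw [log_h hT hz hw h2, ← hmean, abs_le]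
    constructor <;> linarith
  have s1 := sq_le_sq' (neg_le_of_abs_le e1) (le_of_abs_le e1)
  have s2 := sq_le_sq' (neg_le_of_abs_le e4) (le_of_abs_le e4)
  -- The claim is the average of the bounds `s1` and `s2`, divided by the time step.
  refine le_trans ?_ hle
  rw [div_add_div _ _ (by positivity) hT'.ne', div_le_div_iff₀ (by positivity) hT']
  have : 0 < (w.1 - z.1) ^ 2 := by positivity
  nlinarith

/-! ### Finiteness of the cost -/

/-- Two points of `D` with `x ≺ y` are joined by the monotone rational quadratic interpolant. -/
theorem exists_steers {z w : ℝ × ℝ × ℝ} (hT : z.1 < w.1) (hz : 0 < z.2.1) (hw : 0 < w.2.1)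
    (h2 : z.2.2 < w.2.2) : ∃ ω γ₁ γ₂ : ℝ → ℝ, Steers z w ω γ₁ γ₂ := by
  obtain ⟨t, a, b⟩ := z
  obtain ⟨T, c, d⟩ := w
  dsimp only at hT hz hw h2
  have hL : 0 < T - t := sub_pos.2 hT
  obtain ⟨Δ, hΔ⟩ : ∃ Δ, Δ = (d - b) / (T - t) := ⟨_, rfl⟩
  have hΔ0 : 0 < Δ := hΔ ▸ div_pos (sub_pos.2 h2) hL
  have hd : d = b + Δ * (T - t) := by rw [hΔ]; field_simp; ring
  -- With mean slope Δ, take γ₂ = b + Δ(T − t)P/Q. Its derivative is (Δ(T − t))²N/Q², where N and Q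
  -- have positive coefficients, and ω is the logarithmic derivative of that.
  let P : ℝ → ℝ := fun s => Δ * (s - t) ^ 2 + a * ((s - t) * (T - s))
  let Q : ℝ → ℝ := fun s => Δ * ((s - t) ^ 2 + (T - s) ^ 2) + (a + c) * ((s - t) * (T - s))
  let N : ℝ → ℝ := fun s => c * (s - t) ^ 2 + 2 * Δ * ((s - t) * (T - s)) + a * (T - s) ^ 2
  let P' : ℝ → ℝ := fun s => 2 * Δ * (s - t) + a * ((T - s) - (s - t))
  let Q' : ℝ → ℝ := fun s => 2 * Δ * ((s - t) - (T - s)) + (a + c) * ((T - s) - (s - t))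
  let N' : ℝ → ℝ := fun s => 2 * c * (s - t) + 2 * Δ * ((T - s) - (s - t)) - 2 * a * (T - s)
  have hsub : ∀ s : ℝ, HasDerivAt (fun s => s - t) 1 s := fun s => (hasDerivAt_id s).sub_const t
  have hsub' : ∀ s : ℝ, HasDerivAt (fun s => T - s) (-1) s := fun s => (hasDerivAt_id s).const_sub T
  have hP : ∀ s, HasDerivAt P (P' s) s := fun s => by
    convert! (((hsub s).pow 2).const_mul Δ).add (((hsub s).mul (hsub' s)).const_mul a) using 1
    simp only [P']; ring
  have hQ : ∀ s, HasDerivAt Q (Q' s) s := fun s => by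
    convert! ((((hsub s).pow 2).add ((hsub' s).pow 2)).const_mul Δ).add
      (((hsub s).mul (hsub' s)).const_mul (a + c)) using 1
    simp only [Q']; ring
  have hN : ∀ s, HasDerivAt N (N' s) s := fun s => by
    convert! ((((hsub s).pow 2).const_mul c).add
      (((hsub s).mul (hsub' s)).const_mul (2 * Δ))).add (((hsub' s).pow 2).const_mul a) using 1
    simp only [N']; ring
  have hdisj : ∀ s ∈ Icc t T, 0 ≤ s - t ∧ 0 ≤ T - s ∧ (0 < s - t ∨ 0 < T - s) := fun s hs =>
    ⟨sub_nonneg.2 hs.1, sub_nonneg.2 hs.2, by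
      by_contra! hcon; linarith [hcon.1, hcon.2]⟩
  have hQ0 : ∀ s ∈ Icc t T, 0 < Q s := fun s hs => by
    obtain ⟨h0, h1, h | h⟩ := hdisj s hs <;> simp only [Q] <;> positivity
  have hN0 : ∀ s ∈ Icc t T, 0 < N s := fun s hs => by
    obtain ⟨h0, h1, h | h⟩ := hdisj s hs <;> simp only [N] <;> positivity
  have hPc : ContDiff ℝ 1 P := by fun_prop
  have hQc : ContDiff ℝ 1 Q := by fun_prop
  have hNc : ContDiff ℝ 1 N := by fun_prop
  have hQ'c : Continuous Q' := by fun_prop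
  have hN'c : Continuous N' := by fun_prop
  have hωc : ContinuousOn (fun s => N' s / N s - 2 * Q' s / Q s) (Icc t T) :=
    (hN'c.continuousOn.div hNc.continuous.continuousOn fun s hs => (hN0 s hs).ne').sub
      ((hQ'c.continuousOn.const_mul 2).div hQc.continuous.continuousOn fun s hs => (hQ0 s hs).ne')
  refine ⟨fun s => N' s / N s - 2 * Q' s / Q s, fun s => (Δ * (T - t)) ^ 2 * N s / Q s ^ 2,
    fun s => b + Δ * (T - t) * (P s / Q s), ?_⟩
  constructor
  · obtain ⟨B, hB⟩ := isCompact_Icc.exists_bound_of_continuousOn hωc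
    exact MemLp.of_bound (hωc.aestronglyMeasurable measurableSet_Icc) B
      ((ae_restrict_iff' measurableSet_Icc).2 (ae_of_all _ hB))
  · apply ContDiffOn.absolutelyContinuousOnInterval
    rw [uIcc_of_le hT.le]
    exact (contDiffOn_const.mul hNc.contDiffOn).div (hQc.pow 2).contDiffOn
      fun s hs => (pow_pos (hQ0 s hs) 2).ne'
  · apply ContDiffOn.absolutelyContinuousOnInterval
    rw [uIcc_of_le hT.le]
    exact contDiffOn_const.add (contDiffOn_const.mul
      (hPc.contDiffOn.div hQc.contDiffOn fun s hs => (hQ0 s hs).ne'))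
  · intro s hs
    have h1 := hQ0 s hs
    have h3 := hN0 s hs
    change 0 < (Δ * (T - t)) ^ 2 * N s / Q s ^ 2
    positivity
  · refine ae_of_all _ fun s hs => ?_
    have h1 := hQ0 s (Ioo_subset_Icc_self hs)
    have h3 := hN0 s (Ioo_subset_Icc_self hs)
    convert! (((hN s).const_mul ((Δ * (T - t)) ^ 2)).div ((hQ s).pow 2) (pow_pos h1 2).ne') using 1
    simp only [Pi.pow_apply]
    field_simp
    ring
  · refine ae_of_all _ fun s hs => ?_
    have h1 := hQ0 s (Ioo_subset_Icc_self hs)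
    convert! (((hP s).div (hQ s) h1.ne').const_mul (Δ * (T - t))).const_add b using 1
    have key : P' s * Q s - P s * Q' s = Δ * (T - t) * N s := by
      simp only [P, Q, N, P', Q']; ring
    rw [key]
    ring
  · simp only [P, Q, N, Prod.mk.injEq]
    constructor
    · field_simp
      ring
    · simp
  · simp only [P, Q, N, Prod.mk.injEq]
    constructor
    · field_simp
      ring
    · rw [hd]
      field_simp
      ring

theorem Psi_ne_top {z w : ℝ × ℝ × ℝ} (hT : z.1 < w.1) (hz : 0 < z.2.1) (hw : 0 < w.2.1)
    (h2 : z.2.2 < w.2.2) : Psi z w ≠ ⊤ := by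
  obtain ⟨ω, γ₁, γ₂, hS⟩ := exists_steers hT hz hw h2
  refine ne_top_of_le_ne_top ENNReal.ofReal_ne_top
    (iInf_le_of_le ω (iInf_le_of_le γ₁ (iInf_le_of_le γ₂ (iInf_le _ hS))))

end Asian

/-! ### Gaussian integrals in logarithmic coordinates -/

theorem lintegral_exp_mul_sub_sq (β : ℝ) {c : ℝ} (hc : 0 < c) :
    ∫⁻ v : ℝ, ENNReal.ofReal (Real.exp (β * v - v ^ 2 / c)) =
      ENNReal.ofReal (Real.sqrt (Real.pi * c) * Real.exp (β ^ 2 * c / 4)) := by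
  have h : ∀ v : ℝ, Real.exp (β * v - v ^ 2 / c) =
      Real.exp (-(1 / c) * (v - β * c / 2) ^ 2) * Real.exp (β ^ 2 * c / 4) := by
    intro v
    rw [← Real.exp_add]
    congr 1
    field_simp
    ring
  have hi := (integrable_exp_neg_mul_sq (one_div_pos.2 hc)).comp_sub_right (β * c / 2)
  simp_rw [h]
  rw [← ofReal_integral_eq_lintegral_ofReal (hi.mul_const _) (ae_of_all _ fun v => by positivity),
    integral_mul_const, integral_sub_right_eq_self (fun v => Real.exp (-(1 / c) * v ^ 2)),
    integral_gaussian]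
  simp

/-- The sign ε selects the half-line above or below b: the free point lies above x₂ in one kernel
and below 0 in the other. -/
theorem lintegral_comp_add_mul_exp {ε a : ℝ} (b : ℝ) (hε : ε ^ 2 = 1) (ha : 0 < a)
    (F : ℝ → ENNReal) : ∫⁻ y in {y | 0 < ε * (y - b)}, F y =
      ∫⁻ l, ENNReal.ofReal (a * Real.exp l) * F (b + ε * (a * Real.exp l)) := by
  have hε0 : ε ≠ 0 := by rintro rfl; norm_num at hε
  have himg : (fun l => b + ε * (a * Real.exp l)) '' univ = {y | 0 < ε * (y - b)} := by
    ext y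
    simp only [image_univ, mem_range, mem_ofPred_eq]
    constructor
    · rintro ⟨l, rfl⟩
      rw [add_sub_cancel_left, ← mul_assoc, ← sq, hε, one_mul]
      positivity
    · intro hy
      refine ⟨Real.log (ε * (y - b) / a), ?_⟩
      rw [Real.exp_log (by positivity), mul_div_cancel₀ _ ha.ne', ← mul_assoc, ← sq, hε]
      ring
  have hinj : InjOn (fun l => b + ε * (a * Real.exp l)) univ := fun l _ m _ hlm => by
    have := mul_left_cancel₀ ha.ne' (mul_left_cancel₀ hε0 (add_left_cancel hlm))
    exact Real.exp_injective this
  rw [← himg, lintegral_image_eq_lintegral_abs_deriv_mul MeasurableSet.univ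
    (f' := fun l => ε * (a * Real.exp l)) (fun l _ =>
      ((((Real.hasDerivAt_exp l).const_mul a).const_mul ε).const_add b).hasDerivWithinAt) hinj]
  have habs : |ε| = 1 := by rwa [← pow_eq_one_iff_of_nonneg (abs_nonneg _) two_ne_zero, sq_abs]
  simp only [Measure.restrict_univ, abs_mul ε, habs, one_mul]
  exact lintegral_congr fun l => by rw [abs_of_pos (by positivity)]

namespace Asian

/-! ### Uniform bounds for the integrals of the kernels -/

theorem expNegHalf_le {c : ENNReal} {L : ℝ} (h : ENNReal.ofReal L ≤ c) :
    expNegHalf c ≤ Real.exp (-L / 2) := by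
  unfold expNegHalf
  split_ifs with hc
  · positivity
  · have := (ENNReal.ofReal_le_iff_le_toReal hc).1 h
    apply Real.exp_le_exp.2
    linarith

theorem expNegHalf_nonneg (c : ENNReal) : 0 ≤ expNegHalf c := by
  unfold expNegHalf
  split_ifs <;> positivity

theorem H1_nonneg (z w : ℝ × ℝ × ℝ) : 0 ≤ H1 z w :=
  mul_nonneg (by positivity) (expNegHalf_nonneg _)

/-- Gaussian upper bound for the kernels, as a function of the ratio `𝐡`, of the first coordinate
`r` of the free point and of the first coordinate `p` of the fixed one. -/
noncomputable def majorant (T p k η r : ℝ) : ℝ :=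
  gTilde η * (Real.sqrt 12 / (2 * Real.pi * T ^ 2 * p ^ 2)
    * Real.exp (-k * (Real.log r - Real.log p) - (Real.log r - Real.log p) ^ 2 / (4 * T))
    * Real.exp (-Real.log η ^ 2 / T))

theorem h_pos {z w : ℝ × ℝ × ℝ} (hT : z.1 < w.1) (hz : 0 < z.2.1) (hw : 0 < w.2.1)
    (h2 : z.2.2 < w.2.2) : 0 < h z w :=
  div_pos (mul_pos (sub_pos.2 hT) (Real.sqrt_pos.2 (mul_pos hz hw))) (sub_pos.2 h2)

theorem kernel_le_gaussian {φ : ℝ → ℝ} (hφ : ∀ r > 0, 0 < φ r ∧ φ r ≤ gTilde r)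
    {z w : ℝ × ℝ × ℝ} (hT : z.1 < w.1) (hz : 0 < z.2.1) (hw : 0 < w.2.1) (h2 : z.2.2 < w.2.2) :
    kernel φ z w ≤ gTilde (h z w) * (Real.sqrt 12 / (2 * Real.pi * (w.1 - z.1) ^ 2 * w.2.1 ^ 2)
      * (Real.exp (-(Real.log w.2.1 - Real.log z.2.1) ^ 2 / (4 * (w.1 - z.1)))
      * Real.exp (-Real.log (h z w) ^ 2 / (w.1 - z.1)))) := by
  obtain ⟨hφ0, hφg⟩ := hφ (h z w) (h_pos hT hz hw h2)
  unfold kernel H1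
  refine mul_le_mul hφg ?_ (H1_nonneg z w) (hφ0.le.trans hφg)
  refine mul_le_mul_of_nonneg_left ?_ (by positivity)
  refine (expNegHalf_le (le_Psi hT h2)).trans_eq ?_
  rw [← Real.exp_add]
  congr 1
  have := sub_pos.2 hT
  field_simp
  ring

/-- The weight y₁⁻² sits at the free point here; moving it to the fixed one costs the factor with k
= 2. With the end point fixed, k = 0. -/
theorem kernel_le_majorant_right {φ : ℝ → ℝ} (hφ : ∀ r > 0, 0 < φ r ∧ φ r ≤ gTilde r)
    {z w : ℝ × ℝ × ℝ} (hT : z.1 < w.1) (hz : 0 < z.2.1) (hw : 0 < w.2.1) (h2 : z.2.2 < w.2.2) :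
    kernel φ z w ≤ majorant (w.1 - z.1) z.2.1 2 (h z w) w.2.1 := by
  refine (kernel_le_gaussian hφ hT hz hw h2).trans_eq ?_
  unfold majorant
  rw [sub_eq_add_neg (-2 * (Real.log w.2.1 - Real.log z.2.1)), Real.exp_add]
  have : Real.exp (-2 * (Real.log w.2.1 - Real.log z.2.1)) = z.2.1 ^ 2 / w.2.1 ^ 2 := by
    rw [← div_pow, ← Real.exp_log (div_pos hz hw), ← Real.exp_nat_mul, Real.log_div hz.ne' hw.ne']
    congr 1
    push_cast
    ring
  rw [this, ← neg_div]
  have := sub_pos.2 hT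
  field_simp

theorem kernel_le_majorant_left {φ : ℝ → ℝ} (hφ : ∀ r > 0, 0 < φ r ∧ φ r ≤ gTilde r)
    {z w : ℝ × ℝ × ℝ} (hT : z.1 < w.1) (hz : 0 < z.2.1) (hw : 0 < w.2.1) (h2 : z.2.2 < w.2.2) :
    kernel φ z w ≤ majorant (w.1 - z.1) w.2.1 0 (h z w) z.2.1 := by
  refine (kernel_le_gaussian hφ hT hz hw h2).trans_eq ?_
  unfold majorant
  rw [← neg_sub (Real.log w.2.1), neg_sq, neg_zero, zero_mul, zero_sub, ← neg_div]
  ring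

theorem gTilde_exp (l : ℝ) : gTilde (Real.exp l) = Real.exp (l / 2) + Real.exp l := by
  rw [gTilde, Real.exp_half]

/-- The substitution y = b + εT√(pr)eˡ makes the ratio e⁻ˡ, so g̃ becomes two exponentials against a
Gaussian in l. -/
theorem lintegral_majorant_snd {T p r ε : ℝ} (k b : ℝ) (hT : 0 < T) (hp : 0 < p) (hr : 0 < r)
    (hε : ε ^ 2 = 1) :
    ∫⁻ y in {y | 0 < ε * (y - b)},
        ENNReal.ofReal (majorant T p k (T * Real.sqrt (p * r) / (ε * (y - b))) r) ≤
      ENNReal.ofReal (T * Real.sqrt (p * r) * (Real.sqrt 12 / (2 * Real.pi * T ^ 2 * p ^ 2)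
        * Real.exp (-k * (Real.log r - Real.log p) - (Real.log r - Real.log p) ^ 2 / (4 * T)))
        * (2 * (Real.sqrt (Real.pi * T) * Real.exp T))) := by
  set W := Real.sqrt 12 / (2 * Real.pi * T ^ 2 * p ^ 2)
        * Real.exp (-k * (Real.log r - Real.log p) - (Real.log r - Real.log p) ^ 2 / (4 * T))
    with hW
  set a := T * Real.sqrt (p * r) with ha
  have ha0 : 0 < a := by positivity
  have hW0 : 0 ≤ W := by positivity
  rw [lintegral_comp_add_mul_exp b hε ha0]
  have hpt : ∀ l : ℝ, ENNReal.ofReal (a * Real.exp l) * ENNReal.ofReal (majorant T p k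
      (a / (ε * (b + ε * (a * Real.exp l) - b))) r) = ENNReal.ofReal (a * W) *
      (ENNReal.ofReal (Real.exp (1 / 2 * l - l ^ 2 / T))
        + ENNReal.ofReal (Real.exp (0 * l - l ^ 2 / T))) := by
    intro l
    have h1 : a / (ε * (b + ε * (a * Real.exp l) - b)) = Real.exp (-l) := by
      rw [add_sub_cancel_left, ← mul_assoc, ← sq, hε, one_mul, Real.exp_neg]
      field_simp
    rw [h1, ← ENNReal.ofReal_add (by positivity) (by positivity),
      ← ENNReal.ofReal_mul (by positivity), ← ENNReal.ofReal_mul (by positivity)]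
    congr 1
    rw [majorant, ← hW, gTilde_exp, Real.log_exp]
    have e1 : Real.exp (1 / 2 * l - l ^ 2 / T) =
        Real.exp l * Real.exp (-l / 2) * Real.exp (-(-l) ^ 2 / T) := by
      rw [← Real.exp_add, ← Real.exp_add]; congr 1; ring
    have e2 : Real.exp (0 * l - l ^ 2 / T) =
        Real.exp l * Real.exp (-l) * Real.exp (-(-l) ^ 2 / T) := by
      rw [← Real.exp_add, ← Real.exp_add]; congr 1; ring
    rw [e1, e2]
    ring
  simp_rw [hpt]
  rw [lintegral_const_mul _ (by fun_prop), lintegral_add_left (by fun_prop),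
    lintegral_exp_mul_sub_sq _ hT, lintegral_exp_mul_sub_sq _ hT,
    ← ENNReal.ofReal_add (by positivity) (by positivity), ← ENNReal.ofReal_mul (by positivity)]
  apply ENNReal.ofReal_le_ofReal
  refine mul_le_mul_of_nonneg_left ?_ (by positivity)
  rw [two_mul]
  gcongr <;> linarith

/-- With r = peˡ, the Jacobian and √(pr) give the exponent 3/2 − k. The prefactor T⁻²p⁻² cancels
against T√(pr), the Jacobian and two Gaussian factors √T. The rate 4 dominates 1 + (3/2)². -/
theorem lintegral_majorant_le {T p ε k : ℝ} (b : ℝ) (hT : 0 < T) (hp : 0 < p) (hε : ε ^ 2 = 1)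
    (hk : |3 / 2 - k| ≤ 3 / 2) :
    ∫⁻ ξ in Ioi (0 : ℝ) ×ˢ {y | 0 < ε * (y - b)},
        ENNReal.ofReal (majorant T p k (T * Real.sqrt (p * ξ.1) / (ε * (ξ.2 - b))) ξ.1) ≤
      ENNReal.ofReal (2 * Real.sqrt 12 * Real.exp (4 * T)) := by
  rw [Measure.volume_eq_prod, ← Measure.prod_restrict]
  -- This half of Tonelli needs no measurability.
  refine (lintegral_prod_le _).trans ?_
  refine (setLIntegral_mono' measurableSet_Ioi fun r hr =>
    lintegral_majorant_snd k b hT hp hr hε).trans ?_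
  have hset : Ioi (0 : ℝ) = {y | 0 < 1 * (y - 0)} := by ext y; simp
  rw [hset, lintegral_comp_add_mul_exp 0 (by norm_num) hp]
  have hpt : ∀ l : ℝ, ENNReal.ofReal (p * Real.exp l) * ENNReal.ofReal
      (T * Real.sqrt (p * (0 + 1 * (p * Real.exp l)))
        * (Real.sqrt 12 / (2 * Real.pi * T ^ 2 * p ^ 2)
        * Real.exp (-k * (Real.log (0 + 1 * (p * Real.exp l)) - Real.log p)
          - (Real.log (0 + 1 * (p * Real.exp l)) - Real.log p) ^ 2 / (4 * T)))
        * (2 * (Real.sqrt (Real.pi * T) * Real.exp T))) =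
      ENNReal.ofReal (Real.sqrt 12 / (Real.pi * T) * (Real.sqrt (Real.pi * T) * Real.exp T)) *
        ENNReal.ofReal (Real.exp ((3 / 2 - k) * l - l ^ 2 / (4 * T))) := by
    intro l
    rw [← ENNReal.ofReal_mul (by positivity), ← ENNReal.ofReal_mul (by positivity)]
    congr 1
    have h1 : Real.log (0 + 1 * (p * Real.exp l)) - Real.log p = l := by
      rw [zero_add, one_mul, Real.log_mul hp.ne' (Real.exp_pos l).ne', Real.log_exp]; ring
    have h2 : Real.sqrt (p * (0 + 1 * (p * Real.exp l))) = p * Real.exp (l / 2) := by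
      rw [zero_add, one_mul, ← mul_assoc, ← sq, Real.sqrt_mul (by positivity),
        Real.sqrt_sq hp.le, Real.exp_half]
    rw [h1, h2]
    have e1 : Real.exp ((3 / 2 - k) * l - l ^ 2 / (4 * T)) =
        Real.exp l * Real.exp (l / 2) * Real.exp (-k * l - l ^ 2 / (4 * T)) := by
      rw [← Real.exp_add, ← Real.exp_add]; congr 1; ring
    rw [e1]
    field_simp
  simp_rw [hpt]
  rw [lintegral_const_mul _ (by fun_prop), lintegral_exp_mul_sub_sq _ (by positivity),
    ← ENNReal.ofReal_mul (by positivity)]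
  apply ENNReal.ofReal_le_ofReal
  have h4 : Real.sqrt (Real.pi * (4 * T)) = 2 * Real.sqrt (Real.pi * T) := by
    rw [show Real.pi * (4 * T) = 2 ^ 2 * (Real.pi * T) by ring, Real.sqrt_mul (by positivity),
      Real.sqrt_sq (by norm_num)]
  have hsq : Real.sqrt (Real.pi * T) * Real.sqrt (Real.pi * T) = Real.pi * T :=
    Real.mul_self_sqrt (by positivity)
  have h5 : Real.sqrt 12 / (Real.pi * T) * (Real.sqrt (Real.pi * T) * Real.exp T)
      * (Real.sqrt (Real.pi * (4 * T)) * Real.exp ((3 / 2 - k) ^ 2 * (4 * T) / 4)) =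
      2 * Real.sqrt 12 * Real.exp (T + (3 / 2 - k) ^ 2 * T) := by
    rw [h4, Real.exp_add, show (3 / 2 - k) ^ 2 * (4 * T) / 4 = (3 / 2 - k) ^ 2 * T by ring]
    calc _ = 2 * Real.sqrt 12 * (Real.sqrt (Real.pi * T) * Real.sqrt (Real.pi * T)
          / (Real.pi * T)) * (Real.exp T * Real.exp ((3 / 2 - k) ^ 2 * T)) := by ring
      _ = _ := by rw [hsq, div_self (by positivity), mul_one]
  rw [h5]
  have h6 : (3 / 2 - k) ^ 2 ≤ (3 / 2) ^ 2 := sq_le_sq' (neg_le_of_abs_le hk) (le_of_abs_le hk)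
  gcongr
  nlinarith

theorem measurable_gTilde : Measurable gTilde := by
  unfold gTilde
  fun_prop

theorem measurable_majorant {f g : ℝ × ℝ → ℝ} (hf : Measurable f) (hg : Measurable g)
    (T p k : ℝ) : Measurable fun ξ => majorant T p k (f ξ) (g ξ) := by
  unfold majorant
  exact (measurable_gTilde.comp hf).mul (by fun_prop)

theorem gTilde_mul_exp_le {η T : ℝ} (hη : 0 < η) (hT : 0 < T) :
    gTilde η * Real.exp (-Real.log η ^ 2 / T) ≤ 2 * Real.exp T := by
  have h : gTilde η = Real.exp (Real.log η / 2) + Real.exp (Real.log η) := by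
    rw [← gTilde_exp, Real.exp_log hη]
  rw [h, add_mul, ← Real.exp_add, ← Real.exp_add, two_mul]
  set l := Real.log η
  have hl : l - l ^ 2 / T ≤ T / 4 := by
    rw [sub_le_iff_le_add, div_add_div _ _ (by norm_num) hT.ne', le_div_iff₀ (by positivity)]
    nlinarith [sq_nonneg (T - 2 * l)]
  have hl' : l / 2 - l ^ 2 / T ≤ T / 4 := by
    rw [sub_le_iff_le_add, div_add_div _ _ (by norm_num) hT.ne', le_div_iff₀ (by positivity)]
    nlinarith [sq_nonneg (T - 4 * l)]
  gcongr <;> rw [neg_div] <;> linarith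

theorem kernel_le_const {φ : ℝ → ℝ} (hφ : ∀ r > 0, 0 < φ r ∧ φ r ≤ gTilde r)
    {z w : ℝ × ℝ × ℝ} (hT : z.1 < w.1) (hz : 0 < z.2.1) (hw : 0 < w.2.1)
    (h2 : z.2.2 < w.2.2) : kernel φ z w ≤
      Real.sqrt 12 / (2 * Real.pi * (w.1 - z.1) ^ 2) * (2 * Real.exp (w.1 - z.1)) / w.2.1 ^ 2 := by
  have hT' := sub_pos.2 hT
  refine (kernel_le_gaussian hφ hT hz hw h2).trans ?_
  have h1 := gTilde_mul_exp_le (h_pos hT hz hw h2) hT'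
  have h3 : Real.exp (-(Real.log w.2.1 - Real.log z.2.1) ^ 2 / (4 * (w.1 - z.1))) ≤ 1 := by
    rw [Real.exp_le_one_iff, neg_div, neg_nonpos]
    positivity
  set A := Real.sqrt 12 / (2 * Real.pi * (w.1 - z.1) ^ 2 * w.2.1 ^ 2) with hA
  set E := Real.exp (-(Real.log w.2.1 - Real.log z.2.1) ^ 2 / (4 * (w.1 - z.1)))
  have hg : 0 ≤ gTilde (h z w) := by
    have := hφ _ (h_pos hT hz hw h2); linarith
  calc _ = A * E * (gTilde (h z w) * Real.exp (-Real.log (h z w) ^ 2 / (w.1 - z.1))) := by ring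
    _ ≤ A * 1 * (2 * Real.exp (w.1 - z.1)) := by gcongr
    _ = _ := by rw [hA]; field_simp

theorem kernel_pos {φ : ℝ → ℝ} (hφ : ∀ r > 0, 0 < φ r ∧ φ r ≤ gTilde r)
    {z w : ℝ × ℝ × ℝ} (hT : z.1 < w.1) (hz : 0 < z.2.1) (hw : 0 < w.2.1)
    (h2 : z.2.2 < w.2.2) : 0 < kernel φ z w := by
  have hT' := sub_pos.2 hT
  refine mul_pos (hφ _ (h_pos hT hz hw h2)).1 (mul_pos (by positivity) ?_)
  rw [expNegHalf, if_neg (Psi_ne_top hT hz hw h2)]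
  positivity

/-! ### Boundedness of the regions and the reduction -/

theorem kernel_eq_zero {φ : ℝ → ℝ} {z w : ℝ × ℝ × ℝ} (hT : z.1 < w.1) (h2 : w.2.2 ≤ z.2.2) :
    kernel φ z w = 0 := by
  simp [kernel, H1, expNegHalf, Psi_eq_top hT h2]

theorem isBounded_region {φ : ℝ → ℝ} (hφ : ∀ r > 0, 0 < φ r ∧ φ r ≤ gTilde r)
    {t s : ℝ} {x : ℝ × ℝ} (hx : 0 < x.1) (hx2 : x.2 < 0) (hts : t < s)
    (hs : s < 0) : Bornology.IsBounded (region φ t s x) := by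
  have hK : 0 < kernel φ (t, x) unitG := kernel_pos hφ (hts.trans hs) hx one_pos hx2
  set K := kernel φ (t, x) unitG with hKdef
  set C := Real.sqrt 12 / (2 * Real.pi * (s - t) ^ 2) * (2 * Real.exp (s - t)) with hC
  refine ((Metric.isBounded_Icc (0 : ℝ) (Real.sqrt (C / K))).prod
    (Metric.isBounded_Icc x.2 0)).subset fun ξ hξ => ?_
  obtain ⟨hξ1, hξ⟩ := hξ
  rw [lt_min_iff] at hξ
  have h1 : x.2 < ξ.2 := by
    by_contra! hcon
    have := kernel_eq_zero (φ := φ) (z := (t, x)) (w := (s, ξ)) hts hcon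
    linarith [hξ.1]
  have h2 : ξ.2 < 0 := by
    by_contra! hcon
    have := kernel_eq_zero (φ := φ) (z := (s, ξ)) (w := unitG) hs hcon
    linarith [hξ.2]
  refine ⟨⟨le_of_lt hξ1, Real.le_sqrt_of_sq_le ?_⟩, h1.le, h2.le⟩
  have h3 := hξ.1.trans_le
    (kernel_le_const hφ (z := (t, x)) (w := (s, ξ)) hts hx hξ1 h1)
  have hξ0 : 0 < ξ.1 ^ 2 := pow_pos hξ1 2
  rw [le_div_iff₀ hK, mul_comm]
  exact ((lt_div_iff₀ hξ0).1 h3).le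

theorem ConvBound.onRegion {φ : ℝ → ℝ} (hφ : ∀ r > 0, 0 < φ r ∧ φ r ≤ gTilde r)
    {τ C : ℝ} (H : ConvBound φ τ C) : ConvBoundOnRegion φ τ C := by
  intro t x hx hprec hτ s hs
  refine le_trans (setLIntegral_mono' ?_ fun ξ hξ => ?_) (H t x hx hprec hτ s hs)
  · exact (measurableSet_lt measurable_const measurable_fst).inter
      ((measurableSet_lt measurable_const measurable_snd).inter
        (measurableSet_lt measurable_snd measurable_const))
  · obtain ⟨h1, h2, h3⟩ := hξ
    have k1 := (kernel_pos hφ (z := (t, x)) (w := (s, ξ)) hs.1 hx h1 h2).le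
    have k2 := (kernel_pos hφ (z := (s, ξ)) (w := unitG) hs.2 h1 one_pos h3).le
    apply ENNReal.ofReal_le_ofReal
    by_cases hmem : ξ ∈ region φ t s x
    · simp [hmem]
    · simpa [hmem] using mul_nonneg k1 k2

theorem ConvBoundOnRegion.convBound {φ : ℝ → ℝ} (hφ : ∀ r > 0, 0 < φ r ∧ φ r ≤ gTilde r)
    {τ κ : ℝ} (hκ : 0 < κ) (H : ConvBoundOnRegion φ τ κ) :
    ConvBound φ τ (κ + 2 * (2 * Real.sqrt 12 * Real.exp (4 * τ))) := by
  intro t x hx hprec hτ s hs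
  have hx0 : 0 < x.1 := hx
  have hK : 0 < kernel φ (t, x) unitG := kernel_pos hφ hprec.2 hx one_pos hprec.1
  set K := kernel φ (t, x) unitG with hKdef
  set B := 2 * Real.sqrt 12 * Real.exp (4 * τ) with hB
  have hB0 : 0 < B := by positivity
  let m₁ : ℝ × ℝ → ENNReal := fun ξ => ENNReal.ofReal
    (majorant (s - t) x.1 2 ((s - t) * Real.sqrt (x.1 * ξ.1) / (1 * (ξ.2 - x.2))) ξ.1)
  let m₂ : ℝ × ℝ → ENNReal := fun ξ => ENNReal.ofReal
    (majorant (0 - s) 1 0 ((0 - s) * Real.sqrt (1 * ξ.1) / (-1 * (ξ.2 - 0))) ξ.1)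
  have hm₁ : Measurable m₁ :=
    (measurable_majorant (by fun_prop) measurable_fst _ _ _).ennreal_ofReal
  have hm₂ : Measurable m₂ :=
    (measurable_majorant (by fun_prop) measurable_fst _ _ _).ennreal_ofReal
  have hstrip : MeasurableSet (strip x) :=
    (measurableSet_lt measurable_const measurable_fst).inter
      ((measurableSet_lt measurable_const measurable_snd).inter
        (measurableSet_lt measurable_snd measurable_const))
  have hint₁ : ∫⁻ ξ in strip x, m₁ ξ ≤ ENNReal.ofReal B := by
    refine (lintegral_mono_set fun ξ hξ => ?_).trans
      ((lintegral_majorant_le (ε := 1) (k := 2) x.2 (sub_pos.2 hs.1) hx0 (by norm_num)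
        (by rw [abs_le]; norm_num)).trans (ENNReal.ofReal_le_ofReal ?_))
    · refine ⟨hξ.1, ?_⟩
      have : x.2 < ξ.2 := hξ.2.1
      simpa using this
    · rw [hB]
      gcongr
      linarith [hs.2]
  have hint₂ : ∫⁻ ξ in strip x, m₂ ξ ≤ ENNReal.ofReal B := by
    refine (lintegral_mono_set fun ξ hξ => ?_).trans
      ((lintegral_majorant_le (ε := -1) (k := 0) 0 (sub_pos.2 hs.2) one_pos (by norm_num)
        (by rw [abs_le]; norm_num)).trans (ENNReal.ofReal_le_ofReal ?_))
    · refine ⟨hξ.1, ?_⟩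
      have : ξ.2 < 0 := hξ.2.2
      simpa using this
    · rw [hB]
      gcongr
      linarith [hs.1]
  have hpt : ∀ ξ ∈ strip x,
      ENNReal.ofReal (kernel φ (t, x) (s, ξ) * kernel φ (s, ξ) unitG) ≤
      ENNReal.ofReal ((region φ t s x).indicator (fun _ => (1 : ℝ)) ξ
          * kernel φ (t, x) (s, ξ) * kernel φ (s, ξ) unitG)
        + ENNReal.ofReal K * (m₁ ξ + m₂ ξ) := by
    intro ξ hξ
    obtain ⟨h1, h2, h3⟩ := hξ
    by_cases hmem : ξ ∈ region φ t s x
    · simp [hmem]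
    · have k1 := (kernel_pos hφ (z := (t, x)) (w := (s, ξ)) hs.1 hx h1 h2).le
      have k2 := (kernel_pos hφ (z := (s, ξ)) (w := unitG) hs.2 h1 one_pos h3).le
      have b1 := kernel_le_majorant_right hφ (z := (t, x)) (w := (s, ξ)) hs.1 hx h1 h2
      have b2 := kernel_le_majorant_left hφ (z := (s, ξ)) (w := unitG) hs.2 h1 one_pos h3
      have e1 : ENNReal.ofReal (kernel φ (t, x) (s, ξ)) ≤ m₁ ξ :=
        ENNReal.ofReal_le_ofReal (b1.trans_eq (by simp [h]))
      have e2 : ENNReal.ofReal (kernel φ (s, ξ) unitG) ≤ m₂ ξ :=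
        ENNReal.ofReal_le_ofReal (b2.trans_eq (by simp [h, unitG]))
      have hmin : min (kernel φ (t, x) (s, ξ)) (kernel φ (s, ξ) unitG) ≤ K := by
        by_contra! hcon
        exact hmem ⟨h1, hcon⟩
      refine le_add_left (le_trans ?_ (mul_le_mul_right (add_le_add e1 e2) _))
      rw [← ENNReal.ofReal_add k1 k2, ← ENNReal.ofReal_mul hK.le]
      apply ENNReal.ofReal_le_ofReal
      -- Bound the smaller factor by K and the other by the sum of both.
      rcases min_le_iff.1 hmin with h | h <;> nlinarith
  refine (setLIntegral_mono' hstrip hpt).trans ?_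
  -- Splitting the integral needs measurability of the majorants only, not of the kernels or the
  -- region.
  have hm : Measurable fun ξ => m₁ ξ + m₂ ξ := hm₁.add hm₂
  rw [lintegral_add_right _ (hm.const_mul _), lintegral_const_mul _ hm,
    lintegral_add_left hm₁]
  refine (add_le_add (H t x hx hprec hτ s hs)
    (mul_le_mul_right (add_le_add hint₁ hint₂) _)).trans_eq ?_
  rw [← ENNReal.ofReal_add hB0.le hB0.le, ← ENNReal.ofReal_mul hK.le,
    ← ENNReal.ofReal_add (by positivity) (by positivity)]
  congr 1
  ring

theorem sqrt_pos_and_le_gTilde (r : ℝ) (hr : r > 0) :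
    0 < Real.sqrt r ∧ Real.sqrt r ≤ gTilde r :=
  ⟨Real.sqrt_pos.2 hr, le_add_of_nonneg_right hr.le⟩

theorem gTilde_pos_and_le_gTilde (r : ℝ) (hr : r > 0) : 0 < gTilde r ∧ gTilde r ≤ gTilde r :=
  ⟨add_pos (Real.sqrt_pos.2 hr) hr, le_rfl⟩

theorem keyInequalitiesAt_iff (τ : ℝ) : KeyInequalitiesAt τ ↔ ReducedInequalitiesAt τ := by
  constructor
  · rintro ⟨C, hC, h1, h2⟩
    exact ⟨C, hC, h1.onRegion sqrt_pos_and_le_gTilde, h2.onRegion gTilde_pos_and_le_gTilde⟩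
  · rintro ⟨κ, hκ, h1, h2⟩
    exact ⟨_, by positivity, h1.convBound sqrt_pos_and_le_gTilde hκ,
      h2.convBound gTilde_pos_and_le_gTilde hκ⟩

end Asian

theorem proposition5p1 :
    (∀ (t s : ℝ) (x : ℝ × ℝ), x ∈ Asian.stateSpace → Asian.PrecST (t, x) Asian.unitG →
        s ∈ Set.Ioo t 0 →
        Bornology.IsBounded (Asian.region Real.sqrt t s x) ∧
        Bornology.IsBounded (Asian.region Asian.gTilde t s x)) ∧
    (Asian.KeyInequalities ↔ ∀ τ > 0, Asian.ReducedInequalitiesAt τ) ∧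
    (∀ τ > 0, Asian.KeyInequalitiesAt τ ↔ Asian.ReducedInequalitiesAt τ) :=
  ⟨fun _ _ _ hx hprec hs =>
    ⟨Asian.isBounded_region Asian.sqrt_pos_and_le_gTilde hx hprec.1 hs.1 hs.2,
      Asian.isBounded_region Asian.gTilde_pos_and_le_gTilde hx hprec.1 hs.1 hs.2⟩,
    forall₂_congr fun τ _ => Asian.keyInequalitiesAt_iff τ,
    fun τ _ => Asian.keyInequalitiesAt_iff τ⟩
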